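/- A topological space is called resolvable if it has a dense subset whose complement is also dense. No separation axiom is included in complete regularity: $X$ is completely regular if, for every closed set $K \subseteq X$ and every $x \in X\setminus K$, there is a continuous $f\colon X\to[0,1]$ with $f(x)=0$ and $f=1$ on $K$. For a space $X$, let $C_b(X)$ be the vector lattice of bounded continuous real-valued functions on $X$ with the pointwise order, let $Z(f)=\{x\in X: f(x)=0\}$, and let $\mathbf B^s$ be the algebra of subsets of $X$ generated by $\{Z(f): f\in C_b(X)\}$. A Baire measure on $X$ is a finitely additive function $\mu\colon\mathbf B^s\to[0,\infty)$ such that $\mu(B)=\sup\{\mu(Z(f)): f\in C_b(X),\ Z(f)\subseteq B\}$ for all $B\in\mathbf B^s$. It is called normal if $\int_X f_i\,d\mu\uparrow\int_X f\,d\mu$ for every net $f_i\uparrow f$ in $C_b(X)$, i.e. for every increasing net $(f_i)$ in $C_b(X)$ whose supremum in the vector lattice $C_b(X)$ is $f$. **Theorem.** Let $X$ be a non-empty completely regular space. Then there are no non-zero normal Baire measures on $X$ in each of the following cases. 1. $X$ is a separable resolvable $T_1$ space, such as (a) a separable $T_1$ space in which every non-empty open set is uncountable, or (b) a separable $T_1$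 Baire space that has no isolated points. (The spaces in (a), even without the $T_1$ property, and in (b) are indeed resolvable.) 2. $X$ is a metric space such that (a) $X$ is a Baire space that has no isolated points, or (b) $X$ is locally connected, contains at least two points, and contains a point $x_0$ such that $\overline{\{x\in X: d(x_0,x)<r\}}=\{x\in X: d(x_0,x)\le r\}$ for every $r>0$ and $\{d(x_0,x): x\in X\}$ is connected in $\mathbb R$. 3. $X$ is a (not necessarily Hausdorff) real or complex topological vector space such that (a) $X$ is a Baire space and $0$ has an open neighbourhood that is not the whole space, or (b) $0$ has a convex open neighbourhood that is not the whole space. 4. $X$ is a locally connected $T_1$ Baire space that has no isolated points. (The spaces in 2 and 3 are automatically completely regular.) -/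

import Mathlib

open Set
universe u

open scoped BoundedContinuousFunction

/-- A space is resolvable if it has a dense subset with dense complement. -/
def IsResolvable (X : Type*) [TopologicalSpace X] : Prop :=
  ∃ D : Set X, Dense D ∧ Dense Dᶜ

/-- The zero set of a bounded continuous function. -/
def bcfZeroSet {X : Type*} [TopologicalSpace X] (f : X →ᵇ ℝ) : Set X :=
  {x | f x = 0}

/-- The algebra of subsets of `X` (closed under complements and finite unions) that is generated
by the zero sets of the bounded continuous functions on `X`. -/
def zeroSetAlgebra (X : Type*) [TopologicalSpace X] : Set (Set X) :=
  MeasureTheory.generateSetAlgebra (range (bcfZeroSet : (X →ᵇ ℝ) → Set X))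

/-- Baire measures in the finitely additive sense: positive, finite, finitely additive functions
on the algebra generated by the zero sets, inner regular with respect to the zero sets. -/
structure IsBaireMeasure {X : Type*} [TopologicalSpace X] (μ : zeroSetAlgebra X → ℝ) : Prop where
  nonneg : ∀ B, 0 ≤ μ B
  additive : ∀ A B C : zeroSetAlgebra X,
    Disjoint (A : Set X) (B : Set X) → (C : Set X) = (A : Set X) ∪ (B : Set X) → μ C = μ A + μ B
  innerRegular : ∀ B : zeroSetAlgebra X,
    IsLUB {r : ℝ | ∃ Z : zeroSetAlgebra X, (∃ f : X →ᵇ ℝ, (Z : Set X) = bcfZeroSet f) ∧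
      (Z : Set X) ⊆ (B : Set X) ∧ r = μ Z} (μ B)

/-- The numbers `∑ i, c i * μ (A i)`, where `A 0, …, A (n - 1)` is a finite partition of `X` into
members of the algebra and `c i ≤ f` on `A i`, i.e. the integrals of the simple functions that are
dominated by `f`. -/
def lowerSums {X : Type*} [TopologicalSpace X] (μ : zeroSetAlgebra X → ℝ) (f : X →ᵇ ℝ) : Set ℝ :=
  {s : ℝ | ∃ (n : ℕ) (A : Fin n → zeroSetAlgebra X) (c : Fin n → ℝ),
    Pairwise (fun i j => Disjoint (A i : Set X) (A j : Set X)) ∧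
    (⋃ i, (A i : Set X)) = univ ∧
    (∀ i, ∀ x ∈ (A i : Set X), c i ≤ f x) ∧
    s = ∑ i, c i * μ (A i)}

/-- The integral `∫ f dμ` of a bounded continuous function against a positive finitely additive
set function on the zero-set algebra: the supremum of the lower sums. As `f` is bounded, and the
sets `{x | a ≤ f x}` and `{x | f x < b}` lie in the algebra, the supremum is that of a non-empty
bounded set and it equals the infimum of the upper sums. -/
noncomputable def baireIntegral {X : Type*} [TopologicalSpace X] (μ : zeroSetAlgebra X → ℝ)
    (f : X →ᵇ ℝ) : ℝ :=
  sSup (lowerSums μ f)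

/-- `μ` is normal if `∫ f_i dμ ↑ ∫ f dμ` for every increasing net `f_i ↑ f` in the vector lattice
of bounded continuous functions, that is, for every increasing net whose supremum in this lattice
(not necessarily the pointwise supremum) is `f`. Index sets in the universe of `X` suffice,
because the range of an increasing net can serve as its index set. -/
def IsNormalBaire {X : Type u} [TopologicalSpace X] (μ : zeroSetAlgebra X → ℝ) : Prop :=
  ∀ (ι : Type u) [Preorder ι] [IsDirected ι (· ≤ ·)] [Nonempty ι] (F : ι → (X →ᵇ ℝ))
    (f : X →ᵇ ℝ), Monotone F → IsLUB (range F) f →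
      Monotone (fun i => baireIntegral μ (F i)) ∧
        IsLUB (range fun i => baireIntegral μ (F i)) (baireIntegral μ f)

/-- There are no non-zero normal Baire measures on `X`. -/
def NoNonzeroNormalBaireMeasure (X : Type u) [TopologicalSpace X] : Prop :=
  ∀ μ : zeroSetAlgebra X → ℝ, IsBaireMeasure μ → IsNormalBaire μ → μ = 0

open Topology

/-! ### Superadditivity of the integral -/

section Integral

variable {X : Type u} [TopologicalSpace X]

/-! Suprema in $C_b(X)$ are detected on dense sets, so normality makes $\mu$ blind to closed nowhere
dense sets: each has open neighbourhoods of arbitrarily small outer measure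
(`exists_isOpen_outerLE`). It also bounds $\mu(X)$ by $\varepsilon$ whenever a directed family of
open sets of outer measure at most $\varepsilon$ has dense union (`univ_le_of_directedOn_outerLE`).

Hence $\mu = 0$ as soon as countably many closed nowhere dense sets have dense union: give them
neighbourhoods of total measure at most $\varepsilon$ and take finite unions. Such sets are the
points of a countable dense set, maximal $1/(n+1)$-separated sets in a metric space, and the
frontiers of the positive rational multiples of a small neighbourhood of $0$ in a vector space.

A locally connected space is cut instead by nowhere dense sets $N_k$ into connected pieces of
measure at most $1/(k+1)$. Off the closure of a small neighbourhood of all $N_k$, every component is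
open and null, and finite unions of components exhaust what is left. -/

theorem isSetAlgebra_zeroSetAlgebra : MeasureTheory.IsSetAlgebra (zeroSetAlgebra X) :=
  MeasureTheory.isSetAlgebra_generateSetAlgebra

/-- The whole space as a member of the zero-set algebra. -/
def zeroSetAlgebraUniv (X : Type u) [TopologicalSpace X] : zeroSetAlgebra X :=
  ⟨univ, isSetAlgebra_zeroSetAlgebra.univ_mem⟩

variable {μ : zeroSetAlgebra X → ℝ}

namespace IsBaireMeasure

theorem apply_eq_zero_of_empty (hμ : IsBaireMeasure μ) (A : zeroSetAlgebra X)
    (hA : (A : Set X) = ∅) : μ A = 0 := by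
  have h := hμ.additive A A A (by simp [hA]) (by simp)
  linarith

theorem le_univ (hμ : IsBaireMeasure μ) (A : zeroSetAlgebra X) :
    μ A ≤ μ (zeroSetAlgebraUniv X) := by
  have h := hμ.additive A ⟨(A : Set X)ᶜ, isSetAlgebra_zeroSetAlgebra.compl_mem A.2⟩
    (zeroSetAlgebraUniv X) disjoint_compl_right (by simp [zeroSetAlgebraUniv])
  have h' := hμ.nonneg ⟨(A : Set X)ᶜ, isSetAlgebra_zeroSetAlgebra.compl_mem A.2⟩
  linarith

theorem apply_eq_sum_of_eq_biUnion (hμ : IsBaireMeasure μ) {ι : Type*}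
    (s : Finset ι) (A : ι → zeroSetAlgebra X)
    (hA : Pairwise fun i j => Disjoint (A i : Set X) (A j : Set X)) :
    ∀ B : zeroSetAlgebra X, (B : Set X) = ⋃ i ∈ s, (A i : Set X) → μ B = ∑ i ∈ s, μ (A i) := by
  classical
  induction s using Finset.induction_on with
  | empty => intro B hB; simpa using hμ.apply_eq_zero_of_empty B (by simpa using hB)
  | insert a s ha ih =>
    intro B hB
    have hC : (⋃ i ∈ s, (A i : Set X)) ∈ zeroSetAlgebra X :=
      isSetAlgebra_zeroSetAlgebra.biUnion_mem s fun i _ => (A i).2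
    rw [Finset.sum_insert ha, ← ih ⟨_, hC⟩ rfl]
    refine hμ.additive _ _ _ ?_ (by rw [hB, Finset.set_biUnion_insert])
    exact Set.disjoint_iUnion₂_right.2 fun i hi => hA fun h => ha (h ▸ hi)

theorem apply_eq_sum_inter (hμ : IsBaireMeasure μ) {ι : Type*} [Fintype ι]
    (A : ι → zeroSetAlgebra X) (hA : Pairwise fun i j => Disjoint (A i : Set X) (A j : Set X))
    (hU : (⋃ i, (A i : Set X)) = univ) (B : zeroSetAlgebra X) :
    μ B = ∑ i, μ ⟨B ∩ A i, isSetAlgebra_zeroSetAlgebra.inter_mem B.2 (A i).2⟩ := by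
  refine hμ.apply_eq_sum_of_eq_biUnion Finset.univ
    (fun i => ⟨B ∩ A i, isSetAlgebra_zeroSetAlgebra.inter_mem B.2 (A i).2⟩) ?_ B ?_
  · exact fun i j hij => (hA hij).mono inter_subset_right inter_subset_right
  · simp [← inter_iUnion, hU]

theorem univ_eq_sum (hμ : IsBaireMeasure μ) {ι : Type*} [Fintype ι]
    (A : ι → zeroSetAlgebra X) (hA : Pairwise fun i j => Disjoint (A i : Set X) (A j : Set X))
    (hU : (⋃ i, (A i : Set X)) = univ) : μ (zeroSetAlgebraUniv X) = ∑ i, μ (A i) :=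
  hμ.apply_eq_sum_of_eq_biUnion Finset.univ A hA _ (by simp [hU, zeroSetAlgebraUniv])

end IsBaireMeasure

theorem sum_mem_lowerSums {f : X →ᵇ ℝ} {ι : Type*} [Fintype ι]
    (A : ι → zeroSetAlgebra X) (c : ι → ℝ)
    (hA : Pairwise fun i j => Disjoint (A i : Set X) (A j : Set X))
    (hU : (⋃ i, (A i : Set X)) = univ) (hc : ∀ i, ∀ x ∈ (A i : Set X), c i ≤ f x) :
    ∑ i, c i * μ (A i) ∈ lowerSums μ f := by
  let e := (Fintype.equivFin ι).symm
  refine ⟨Fintype.card ι, A ∘ e, c ∘ e, fun i j hij => hA (e.injective.ne hij), ?_,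
    fun i => hc (e i), ?_⟩
  · rw [← hU]
    exact e.surjective.iUnion_comp fun i => (A i : Set X)
  · exact (Equiv.sum_comp e fun i => c i * μ (A i)).symm

theorem mul_univ_mem_lowerSums {f : X →ᵇ ℝ} {c : ℝ} (hc : ∀ x, c ≤ f x) :
    c * μ (zeroSetAlgebraUniv X) ∈ lowerSums μ f := by
  simpa using sum_mem_lowerSums (μ := μ) (f := f) (fun _ : Unit => zeroSetAlgebraUniv X)
    (fun _ => c) (fun i j h => (h rfl).elim) (iUnion_const _) fun _ x _ => hc x

theorem lowerSums_nonempty (f : X →ᵇ ℝ) : (lowerSums μ f).Nonempty :=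
  ⟨_, mul_univ_mem_lowerSums (c := -‖f‖) fun x => (abs_le.1 (f.norm_coe_le_norm x)).1⟩

namespace IsBaireMeasure

theorem le_of_mem_lowerSums (hμ : IsBaireMeasure μ) {f : X →ᵇ ℝ} {c : ℝ} (hc : ∀ x, f x ≤ c)
    {s : ℝ} (hs : s ∈ lowerSums μ f) : s ≤ c * μ (zeroSetAlgebraUniv X) := by
  obtain ⟨n, A, d, hA, hU, hd, rfl⟩ := hs
  rw [hμ.univ_eq_sum A hA hU, Finset.mul_sum]
  refine Finset.sum_le_sum fun i _ => ?_
  rcases (A i : Set X).eq_empty_or_nonempty with h | ⟨x, hx⟩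
  · simp [hμ.apply_eq_zero_of_empty _ h]
  · exact mul_le_mul_of_nonneg_right ((hd i x hx).trans (hc x)) (hμ.nonneg _)

theorem bddAbove_lowerSums (hμ : IsBaireMeasure μ) (f : X →ᵇ ℝ) : BddAbove (lowerSums μ f) :=
  ⟨_, fun _ hs => hμ.le_of_mem_lowerSums (fun x => (abs_le.1 (f.norm_coe_le_norm x)).2) hs⟩

theorem baireIntegral_le (hμ : IsBaireMeasure μ) {f : X →ᵇ ℝ} {c : ℝ} (hc : ∀ x, f x ≤ c) :
    baireIntegral μ f ≤ c * μ (zeroSetAlgebraUniv X) :=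
  csSup_le (lowerSums_nonempty f) fun _ hs => hμ.le_of_mem_lowerSums hc hs

theorem le_baireIntegral (hμ : IsBaireMeasure μ) {f : X →ᵇ ℝ} {c : ℝ} (hc : ∀ x, c ≤ f x) :
    c * μ (zeroSetAlgebraUniv X) ≤ baireIntegral μ f :=
  le_csSup (hμ.bddAbove_lowerSums f) (mul_univ_mem_lowerSums hc)

theorem baireIntegral_mono (hμ : IsBaireMeasure μ) {f g : X →ᵇ ℝ} (h : f ≤ g) :
    baireIntegral μ f ≤ baireIntegral μ g := by
  refine csSup_le_csSup (hμ.bddAbove_lowerSums g) (lowerSums_nonempty f) ?_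
  rintro s ⟨n, A, c, hA, hU, hc, rfl⟩
  exact ⟨n, A, c, hA, hU, fun i x hx => (hc i x hx).trans (h x), rfl⟩

/-- Both sums are rewritten over the common refinement of the two partitions. -/
theorem add_mem_lowerSums (hμ : IsBaireMeasure μ) {f g : X →ᵇ ℝ} {s t : ℝ}
    (hs : s ∈ lowerSums μ f) (ht : t ∈ lowerSums μ g) : s + t ∈ lowerSums μ (f + g) := by
  obtain ⟨n, A, c, hA, hAU, hc, rfl⟩ := hs
  obtain ⟨m, B, d, hB, hBU, hd, rfl⟩ := ht
  let C : Fin n × Fin m → zeroSetAlgebra X := fun p =>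
    ⟨A p.1 ∩ B p.2, isSetAlgebra_zeroSetAlgebra.inter_mem (A p.1).2 (B p.2).2⟩
  have key : ∑ p, (c p.1 + d p.2) * μ (C p) ∈ lowerSums μ (f + g) := by
    refine sum_mem_lowerSums C (fun p => c p.1 + d p.2) ?_ ?_ ?_
    · rintro ⟨i, j⟩ ⟨i', j'⟩ hne
      by_cases hi : i = i'
      · have hj : j ≠ j' := fun hj => hne (by rw [hi, hj])
        exact (hB hj).mono inter_subset_right inter_subset_right
      · exact (hA hi).mono inter_subset_left inter_subset_left
    · refine eq_univ_of_forall fun x => ?_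
      obtain ⟨i, hi⟩ := mem_iUnion.1 (hAU ▸ mem_univ x)
      obtain ⟨j, hj⟩ := mem_iUnion.1 (hBU ▸ mem_univ x)
      exact mem_iUnion.2 ⟨(i, j), hi, hj⟩
    · exact fun p x hx => add_le_add (hc _ x hx.1) (hd _ x hx.2)
  convert key using 1
  simp only [add_mul, Finset.sum_add_distrib]
  congr 1
  · rw [Fintype.sum_prod_type]
    refine Finset.sum_congr rfl fun i _ => ?_
    rw [hμ.apply_eq_sum_inter B hB hBU (A i), Finset.mul_sum]
  · rw [Fintype.sum_prod_type_right]
    refine Finset.sum_congr rfl fun j _ => ?_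
    rw [hμ.apply_eq_sum_inter A hA hAU (B j), Finset.mul_sum]
    simp only [C, inter_comm]

/-- This half of additivity, with monotonicity and the bounds by constants, suffices for all
estimates below. -/
theorem add_baireIntegral_le (hμ : IsBaireMeasure μ) (f g : X →ᵇ ℝ) :
    baireIntegral μ f + baireIntegral μ g ≤ baireIntegral μ (f + g) := by
  have h : ∀ s ∈ lowerSums μ f, ∀ t ∈ lowerSums μ g, s + t ≤ baireIntegral μ (f + g) :=
    fun s hs t ht => le_csSup (hμ.bddAbove_lowerSums _) (hμ.add_mem_lowerSums hs ht)
  have h' : baireIntegral μ f ≤ baireIntegral μ (f + g) - baireIntegral μ g :=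
    csSup_le (lowerSums_nonempty f) fun s hs => le_sub_comm.1 <|
      csSup_le (lowerSums_nonempty g) fun t ht => by linarith [h s hs t ht]
  linarith

theorem baireIntegral_one (hμ : IsBaireMeasure μ) :
    baireIntegral μ 1 = μ (zeroSetAlgebraUniv X) :=
  le_antisymm (by simpa using hμ.baireIntegral_le (f := 1) (c := 1) fun _ => le_rfl)
    (by simpa using hμ.le_baireIntegral (f := 1) (c := 1) fun _ => le_rfl)

theorem eq_zero_of_univ_le (hμ : IsBaireMeasure μ)
    (h : ∀ ε : ℝ, 0 < ε → μ (zeroSetAlgebraUniv X) ≤ ε) : μ = 0 := by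
  funext A
  exact le_antisymm ((hμ.le_univ A).trans (le_of_forall_pos_le_add fun ε hε => by
    simpa using h ε hε)) (hμ.nonneg A)

end IsBaireMeasure

end Integral

/-! ### Outer measure and the consequences of normality -/

section OuterMeasure

variable {X : Type u} [TopologicalSpace X] {μ : zeroSetAlgebra X → ℝ}

/-- The set `A` has outer measure at most `ε` in the sense that some continuous function below `1`
that is nonpositive on `A` has an integral of at least `μ X - ε`. -/
def OuterLE (μ : zeroSetAlgebra X → ℝ) (A : Set X) (ε : ℝ) : Prop :=
  ∃ f : X →ᵇ ℝ, f ≤ 1 ∧ (∀ x ∈ A, f x ≤ 0) ∧ μ (zeroSetAlgebraUniv X) - ε ≤ baireIntegral μ f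

namespace OuterLE

theorem mono {A B : Set X} {ε δ : ℝ} (h : OuterLE μ B ε) (hAB : A ⊆ B) (hε : ε ≤ δ) :
    OuterLE μ A δ := by
  obtain ⟨f, h1, h0, hf⟩ := h
  exact ⟨f, h1, fun x hx => h0 x (hAB hx), by linarith⟩

theorem empty (hμ : IsBaireMeasure μ) : OuterLE μ (∅ : Set X) 0 :=
  ⟨1, le_rfl, by simp, by simp [hμ.baireIntegral_one]⟩

theorem union (hμ : IsBaireMeasure μ) {A B : Set X} {ε δ : ℝ} (hA : OuterLE μ A ε)
    (hB : OuterLE μ B δ) : OuterLE μ (A ∪ B) (ε + δ) := by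
  obtain ⟨f, f1, f0, hf⟩ := hA
  obtain ⟨g, g1, g0, hg⟩ := hB
  refine ⟨f ⊓ g, inf_le_left.trans f1, ?_, ?_⟩
  · rintro x (hx | hx)
    · exact inf_le_left.trans (f0 x hx)
    · exact inf_le_right.trans (g0 x hx)
  · have h1 := hμ.add_baireIntegral_le (f + g) (-1)
    have h2 := hμ.add_baireIntegral_le f g
    have h3 := hμ.le_baireIntegral (f := -1) (c := -1) fun _ => le_rfl
    -- Since both functions are at most 1, the minimum loses at most the sum of the two defects.
    have h4 : f + g + -1 ≤ f ⊓ g := by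
      intro x
      have hf1 : f x ≤ 1 := f1 x
      have hg1 : g x ≤ 1 := g1 x
      change f x + g x + -1 ≤ min (f x) (g x)
      exact le_min (by linarith) (by linarith)
    have h5 := hμ.baireIntegral_mono h4
    linarith

theorem biUnion (hμ : IsBaireMeasure μ) {ι : Type*} (s : Finset ι) {A : ι → Set X} {ε : ι → ℝ}
    (h : ∀ i ∈ s, OuterLE μ (A i) (ε i)) : OuterLE μ (⋃ i ∈ s, A i) (∑ i ∈ s, ε i) := by
  classical
  induction s using Finset.induction_on with
  | empty => simpa using empty hμ
  | insert a s ha ih =>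
    rw [Finset.set_biUnion_insert, Finset.sum_insert ha]
    exact (h a (Finset.mem_insert_self a s)).union hμ
      (ih fun i hi => h i (Finset.mem_insert_of_mem hi))

end OuterLE

theorem exists_bcf_one_zero [CompletelyRegularSpace X] {K : Set X} (hK : IsClosed K) {x : X}
    (hx : x ∉ K) : ∃ f : X →ᵇ ℝ, f ≤ 1 ∧ f x = 1 ∧ ∀ y ∈ K, f y = 0 := by
  obtain ⟨g, hg, hgx, hgK⟩ := CompletelyRegularSpace.completely_regular x K hK hx
  refine ⟨BoundedContinuousFunction.ofNormedAddCommGroup (fun y => 1 - (g y : ℝ))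
    (by fun_prop) 1 fun y => ?_, fun y => ?_, ?_, fun y hy => ?_⟩
  · rw [Real.norm_eq_abs, abs_of_nonneg (sub_nonneg.2 (g y).2.2)]
    linarith [(g y).2.1]
  · change 1 - (g y : ℝ) ≤ 1
    linarith [(g y).2.1]
  · simp [hgx]
  · simp [hgK hy]

/-- An upper bound of `S` is at least 1 on the dense set `D`, hence everywhere by continuity. So the
lattice supremum of `S` is 1, and normality applies to `S` indexed by itself. -/
theorem IsNormalBaire.exists_lt_baireIntegral (hμ : IsBaireMeasure μ) (hn : IsNormalBaire μ)
    {S : Set (X →ᵇ ℝ)} (hne : S.Nonempty) (hdir : DirectedOn (· ≤ ·) S) (h1 : ∀ f ∈ S, f ≤ 1)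
    {D : Set X} (hD : Dense D) (hS : ∀ x ∈ D, ∃ f ∈ S, 1 ≤ f x) {ε : ℝ} (hε : 0 < ε) :
    ∃ f ∈ S, μ (zeroSetAlgebraUniv X) - ε < baireIntegral μ f := by
  have : Nonempty S := hne.to_subtype
  have : IsDirected S (· ≤ ·) := directedOn_iff_isDirectedOrder.1 hdir
  have hlub : IsLUB (range fun f : S => (f : X →ᵇ ℝ)) 1 := by
    refine ⟨by rintro _ ⟨f, rfl⟩; exact h1 f f.2, fun h hh => ?_⟩
    have hcl : IsClosed {x | 1 ≤ h x} := isClosed_le continuous_const h.continuous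
    have hsub : D ⊆ {x | 1 ≤ h x} := fun x hx => by
      obtain ⟨f, hf, hfx⟩ := hS x hx
      exact hfx.trans (hh ⟨⟨f, hf⟩, rfl⟩ x)
    intro x
    exact closure_minimal hsub hcl (hD x)
  have h := (hn S (fun f => f) 1 (fun _ _ h => h) hlub).2
  rw [hμ.baireIntegral_one] at h
  obtain ⟨_, ⟨f, rfl⟩, hf, -⟩ := h.exists_between (sub_lt_self _ hε)
  exact ⟨f, f.2, hf⟩

theorem exists_isOpen_outerLE [CompletelyRegularSpace X] (hμ : IsBaireMeasure μ)
    (hn : IsNormalBaire μ) {N : Set X} (hN : IsClosed N) (hN' : interior N = ∅) {ε : ℝ}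
    (hε : 0 < ε) : ∃ V, IsOpen V ∧ N ⊆ V ∧ OuterLE μ V ε := by
  obtain ⟨f, ⟨f1, V, hV, hNV, f0⟩, hf⟩ := hn.exists_lt_baireIntegral hμ
    (S := {f | f ≤ 1 ∧ ∃ V, IsOpen V ∧ N ⊆ V ∧ ∀ x ∈ V, f x ≤ 0})
    ⟨0, fun _ => zero_le_one, univ, isOpen_univ, subset_univ _, fun _ _ => le_rfl⟩
    (by
      rintro f ⟨f1, V, hV, hNV, f0⟩ g ⟨g1, W, hW, hNW, g0⟩
      exact ⟨f ⊔ g, ⟨sup_le f1 g1, V ∩ W, hV.inter hW, subset_inter hNV hNW,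
        fun x hx => sup_le (f0 x hx.1) (g0 x hx.2)⟩, le_sup_left, le_sup_right⟩)
    (fun f hf => hf.1) (interior_eq_empty_iff_dense_compl.1 hN')
    (by
      intro x hx
      obtain ⟨f, f1, fx, f0⟩ := exists_bcf_one_zero hN hx
      -- Passing from `f` to `2f - 1` makes the function nonpositive on a whole neighbourhood of
      -- `N`, not only on `N`.
      refine ⟨f + f - 1, ⟨fun y => ?_, {y | f y < 1 / 2},
        isOpen_lt f.continuous continuous_const, fun y hy => ?_, fun y hy => ?_⟩, ?_⟩
      · have : f y ≤ 1 := f1 y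
        change f y + f y - 1 ≤ 1
        linarith
      · simp [f0 y hy]
      · change f y + f y - 1 ≤ 0
        have : f y < 1 / 2 := hy
        linarith
      · change 1 ≤ f x + f x - 1
        linarith)
    hε
  exact ⟨V, hV, hNV, f, f1, f0, hf.le⟩

/-- Normality yields `p ≤ 1`, nonpositive off some `A ∈ S`, with integral almost $\mu(X)$. If `f`
witnesses that `A` is small, then `p + f ≤ 1`, so the two integrals add up to at most $\mu(X)$. -/
theorem univ_le_of_directedOn_outerLE [CompletelyRegularSpace X] (hμ : IsBaireMeasure μ)
    (hn : IsNormalBaire μ) {S : Set (Set X)} (hne : S.Nonempty) (hdir : DirectedOn (· ⊆ ·) S)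
    (ho : ∀ A ∈ S, IsOpen A) (hd : Dense (⋃₀ S)) {ε : ℝ} (hS : ∀ A ∈ S, OuterLE μ A ε) :
    μ (zeroSetAlgebraUniv X) ≤ ε := by
  refine le_of_forall_pos_le_add fun δ hδ => ?_
  obtain ⟨p, ⟨p1, A, hA, p0⟩, hp⟩ := hn.exists_lt_baireIntegral hμ
    (S := {p | p ≤ 1 ∧ ∃ A ∈ S, ∀ x ∉ A, p x ≤ 0})
    (let ⟨A, hA⟩ := hne; ⟨0, fun _ => zero_le_one, A, hA, fun _ _ => le_rfl⟩)
    (by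
      rintro f ⟨f1, A, hA, f0⟩ g ⟨g1, B, hB, g0⟩
      obtain ⟨C, hC, hAC, hBC⟩ := hdir A hA B hB
      exact ⟨f ⊔ g, ⟨sup_le f1 g1, C, hC, fun x hx =>
        sup_le (f0 x fun h => hx (hAC h)) (g0 x fun h => hx (hBC h))⟩, le_sup_left, le_sup_right⟩)
    (fun f hf => hf.1) hd
    (by
      rintro x ⟨A, hA, hx⟩
      obtain ⟨f, f1, fx, f0⟩ := exists_bcf_one_zero (ho A hA).isClosed_compl (not_not.2 hx)
      exact ⟨f, ⟨f1, A, hA, fun y hy => (f0 y hy).le⟩, fx.ge⟩)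
    hδ
  obtain ⟨f, f1, f0, hf⟩ := hS A hA
  have h1 := hμ.add_baireIntegral_le p f
  have h2 := hμ.baireIntegral_le (f := p + f) (c := 1) fun x => by
    change p x + f x ≤ 1
    have hp1 : p x ≤ 1 := p1 x
    have hf1 : f x ≤ 1 := f1 x
    by_cases hx : x ∈ A
    · linarith [f0 x hx]
    · linarith [p0 x hx]
  linarith

/-- Neighbourhoods of total measure at most `ε` of countably many closed nowhere dense sets. -/
theorem exists_seq_isOpen_outerLE [CompletelyRegularSpace X] (hμ : IsBaireMeasure μ)
    (hn : IsNormalBaire μ) {N : ℕ → Set X} (hN : ∀ k, IsClosed (N k))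
    (hN' : ∀ k, interior (N k) = ∅) {ε : ℝ} (hε : 0 < ε) :
    ∃ V : ℕ → Set X, (∀ k, IsOpen (V k)) ∧ (∀ k, N k ⊆ V k) ∧
      ∀ s : Finset ℕ, OuterLE μ (⋃ k ∈ s, V k) ε := by
  -- The bounds form a geometric series with sum `ε`.
  choose V hV hNV hVε using fun k => exists_isOpen_outerLE hμ hn (hN k) (hN' k)
    (ε := ε / 2 / 2 ^ k) (by positivity)
  refine ⟨V, hV, hNV, fun s => (OuterLE.biUnion hμ s fun k _ => hVε k).mono le_rfl ?_⟩
  have h := (summable_geometric_two' ε).sum_le_tsum s fun k _ => by positivity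
  rwa [tsum_geometric_two'] at h

theorem noNonzeroNormalBaireMeasure_of_dense_iUnion [CompletelyRegularSpace X] {ι : Type*}
    [Countable ι] {N : ι → Set X} (hN : ∀ i, IsClosed (N i)) (hN' : ∀ i, interior (N i) = ∅)
    (hd : Dense (⋃ i, N i)) : NoNonzeroNormalBaireMeasure X := by
  intro μ hμ hn
  refine hμ.eq_zero_of_univ_le fun ε hε => ?_
  rcases isEmpty_or_nonempty ι with hι | hι
  · refine univ_le_of_directedOn_outerLE hμ hn (S := {∅}) (singleton_nonempty _)
      (directedOn_singleton _) (by simp) (by simpa using hd) ?_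
    rintro A rfl
    exact (OuterLE.empty hμ).mono le_rfl hε.le
  obtain ⟨e, he⟩ := exists_surjective_nat ι
  obtain ⟨V, hV, hNV, hVε⟩ := exists_seq_isOpen_outerLE hμ hn (fun k => hN (e k))
    (fun k => hN' (e k)) hε
  refine univ_le_of_directedOn_outerLE hμ hn (S := range fun s : Finset ℕ => ⋃ k ∈ s, V k)
    (range_nonempty _) ?_ ?_ ?_ ?_
  · rw [directedOn_range]
    classical
    exact Monotone.directed_le fun s t h => biUnion_subset_biUnion_left h
  · rintro _ ⟨s, rfl⟩
    exact isOpen_biUnion fun k _ => hV k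
  · refine hd.mono (iUnion_subset fun i x hx => ?_)
    obtain ⟨k, rfl⟩ := he i
    exact ⟨_, ⟨{k}, rfl⟩, by simpa using hNV k hx⟩
  · rintro _ ⟨s, rfl⟩
    exact hVε s

end OuterMeasure

/-! ### Separable spaces -/

section Separable

variable {X : Type u} [TopologicalSpace X]

theorem interior_singleton_eq_empty {x : X} (hx : ¬ IsOpen ({x} : Set X)) :
    interior ({x} : Set X) = ∅ := by
  rcases subset_singleton_iff_eq.1 (interior_subset : interior {x} ⊆ {x}) with h | h
  · exact h
  · exact (hx (h ▸ isOpen_interior)).elim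

theorem IsResolvable.not_isOpen_singleton (h : IsResolvable X) (x : X) :
    ¬ IsOpen ({x} : Set X) := by
  obtain ⟨D, hD, hD'⟩ := h
  intro hx
  obtain ⟨y, rfl, hy⟩ := hD.inter_open_nonempty _ hx (singleton_nonempty x)
  obtain ⟨z, rfl, hz⟩ := hD'.inter_open_nonempty _ hx (singleton_nonempty y)
  exact hz hy

theorem isResolvable_of_not_countable [TopologicalSpace.SeparableSpace X]
    (h : ∀ U : Set X, IsOpen U → U.Nonempty → ¬ U.Countable) : IsResolvable X := by
  obtain ⟨D, hDc, hD⟩ := TopologicalSpace.exists_countable_dense X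
  refine ⟨D, hD, interior_eq_empty_iff_dense_compl.1 <| not_nonempty_iff_eq_empty.1 fun hne => ?_⟩
  exact h _ isOpen_interior hne (hDc.mono interior_subset)

theorem isResolvable_of_baireSpace [TopologicalSpace.SeparableSpace X] [T1Space X] [BaireSpace X]
    (h : ∀ x : X, ¬ IsOpen ({x} : Set X)) : IsResolvable X := by
  obtain ⟨D, hDc, hD⟩ := TopologicalSpace.exists_countable_dense X
  refine ⟨D, hD, ?_⟩
  have hd : Dense (⋂ x ∈ D, ({x} : Set X)ᶜ) :=
    dense_biInter_of_isOpen (fun x _ => isOpen_compl_singleton) hDc fun x _ =>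
      interior_eq_empty_iff_dense_compl.1 (interior_singleton_eq_empty (h x))
  refine hd.mono fun x hx hxD => ?_
  exact mem_iInter₂.1 hx x hxD rfl

theorem noNonzeroNormalBaireMeasure_of_separable [CompletelyRegularSpace X] [T1Space X]
    [TopologicalSpace.SeparableSpace X] (h : ∀ x : X, ¬ IsOpen ({x} : Set X)) :
    NoNonzeroNormalBaireMeasure X := by
  obtain ⟨D, hDc, hD⟩ := TopologicalSpace.exists_countable_dense X
  have := hDc.to_subtype
  exact noNonzeroNormalBaireMeasure_of_dense_iUnion (N := fun x : D => {(x : X)})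
    (fun _ => isClosed_singleton) (fun x => interior_singleton_eq_empty (h x))
    (hD.mono fun x hx => mem_iUnion.2 ⟨⟨x, hx⟩, rfl⟩)

end Separable

/-! ### Metric spaces -/

section Metric

variable {X : Type u} [MetricSpace X]

theorem exists_separated_net (X : Type u) [MetricSpace X] {ε : ℝ} (hε : 0 < ε) :
    ∃ S : Set X, (S.Pairwise fun x y => ε ≤ dist x y) ∧ ∀ x, ∃ y ∈ S, dist x y < ε := by
  obtain ⟨S, hS⟩ := zorn_subset {S : Set X | S.Pairwise fun x y => ε ≤ dist x y}
    fun c hc hch => ⟨⋃₀ c, (pairwise_sUnion hch.directedOn).2 hc, fun s => subset_sUnion_of_mem⟩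
  refine ⟨S, hS.prop, fun x => ?_⟩
  by_contra! hx
  have hmem : x ∈ S := hS.le_of_ge (y := insert x S)
    (hS.prop.insert fun y hy _ => ⟨hx y hy, by rw [dist_comm]; exact hx y hy⟩)
    (subset_insert x S) (mem_insert x S)
  have := hx x hmem
  rw [dist_self] at this
  linarith

/-- An interior point of a separated set would be isolated in the whole space. -/
theorem interior_eq_empty_of_pairwise_le_dist {S : Set X} {ε : ℝ} (hε : 0 < ε)
    (hS : S.Pairwise fun x y => ε ≤ dist x y) (h : ∀ x : X, ¬ IsOpen ({x} : Set X)) :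
    interior S = ∅ := by
  refine eq_empty_of_forall_notMem fun x hx => h x ?_
  have : ({x} : Set X) = interior S ∩ Metric.ball x ε := by
    refine Subset.antisymm (singleton_subset_iff.2 ⟨hx, Metric.mem_ball_self hε⟩) ?_
    rintro y ⟨hy, hyx⟩
    by_contra hne
    exact absurd (hS (interior_subset hy) (interior_subset hx) hne) (not_le.2 hyx)
  rw [this]
  exact isOpen_interior.inter Metric.isOpen_ball

theorem noNonzeroNormalBaireMeasure_of_metricSpace (h : ∀ x : X, ¬ IsOpen ({x} : Set X)) :
    NoNonzeroNormalBaireMeasure X := by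
  have hpos : ∀ n : ℕ, (0 : ℝ) < 1 / (n + 1) := fun n => Nat.one_div_pos_of_nat
  choose S hS hd using fun n : ℕ => exists_separated_net X (hpos n)
  refine noNonzeroNormalBaireMeasure_of_dense_iUnion (N := S)
    (fun n => Metric.isClosed_of_pairwise_le_dist (hpos n) (hS n))
    (fun n => interior_eq_empty_of_pairwise_le_dist (hpos n) (hS n) h) fun x => ?_
  refine Metric.mem_closure_iff.2 fun ε hε => ?_
  obtain ⟨n, hn⟩ := exists_nat_one_div_lt hε
  obtain ⟨y, hy, hxy⟩ := hd n x
  exact ⟨y, mem_iUnion.2 ⟨n, hy⟩, hxy.trans hn⟩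

/-- The centre is not isolated because connectedness gives arbitrarily small positive distances from
it. Any other `p` is in the closure of the open ball about `x₀` of radius `dist x₀ p`, which omits
`p`. -/
theorem not_isOpen_singleton_of_closure_ball [Nontrivial X] {x₀ : X}
    (hcl : ∀ r : ℝ, 0 < r → closure {x : X | dist x₀ x < r} = {x : X | dist x₀ x ≤ r})
    (hconn : IsConnected {t : ℝ | ∃ x : X, dist x₀ x = t}) (p : X) :
    ¬ IsOpen ({p} : Set X) := by
  intro hp
  rcases eq_or_ne p x₀ with rfl | hne
  · obtain ⟨q, hq⟩ := exists_ne p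
    obtain ⟨ε, hε, hball⟩ := Metric.isOpen_iff.1 hp p rfl
    have hpos : 0 < dist p q := dist_pos.2 hq.symm
    obtain ⟨x, hx⟩ := hconn.isPreconnected.ordConnected.out ⟨p, dist_self p⟩ ⟨q, rfl⟩
      (⟨by positivity, (min_le_right _ _).trans (half_le_self hpos.le)⟩ :
        min (ε / 2) (dist p q / 2) ∈ Icc 0 (dist p q))
    have hmin : 0 < min (ε / 2) (dist p q / 2) := by positivity
    have hlt : dist x p < ε := by
      rw [dist_comm, hx]
      exact (min_le_left _ _).trans_lt (half_lt_self hε)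
    have hxp : x = p := hball hlt
    rw [hxp, dist_self] at hx
    exact hmin.ne hx
  · have hpos : 0 < dist x₀ p := dist_pos.2 hne.symm
    have hmem : p ∈ closure {x : X | dist x₀ x < dist x₀ p} := by
      rw [hcl _ hpos]
      exact le_refl (dist x₀ p)
    obtain ⟨y, rfl, hy⟩ := mem_closure_iff.1 hmem _ hp rfl
    exact lt_irrefl (dist x₀ y) hy

end Metric

/-! ### Topological vector spaces -/

section TopologicalVectorSpace

theorem IsPreconnected.inter_frontier_nonempty_of_inter_compl {X : Type*} [TopologicalSpace X]
    {C A : Set X} (hC : IsPreconnected C) (h : (C ∩ A).Nonempty) (h' : (C ∩ Aᶜ).Nonempty) :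
    (C ∩ frontier A).Nonempty := by
  by_contra hf
  have hsub : C ⊆ interior A ∪ (closure A)ᶜ := fun x hx => by
    by_contra hxu
    rw [mem_union, not_or, notMem_compl_iff] at hxu
    exact hf ⟨x, hx, hxu.2, hxu.1⟩
  have hdisj : Disjoint (interior A) (closure A)ᶜ :=
    disjoint_compl_right.mono_left (interior_subset.trans subset_closure)
  rcases IsPreconnected.subset_or_subset isOpen_interior isClosed_closure.isOpen_compl hdisj hsub
    hC with hs | hs
  · obtain ⟨x, hx, hxA⟩ := h'
    exact hxA (interior_subset (hs hx))
  · obtain ⟨x, hx, hxA⟩ := h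
    exact hs hx (subset_closure hxA)

variable {X : Type u} [AddCommGroup X] [Module ℝ X] [TopologicalSpace X]
  [IsTopologicalAddGroup X] [ContinuousSMul ℝ X]

open Pointwise

/-- Translates of balanced neighbourhoods of 0 are star-shaped, hence connected. -/
theorem exists_isPreconnected_mem_nhds {x : X} {O : Set X} (hO : O ∈ 𝓝 x) :
    ∃ V ∈ 𝓝 x, V ⊆ O ∧ IsPreconnected V := by
  have h0 : (fun y => x + y) ⁻¹' O ∈ 𝓝 (0 : X) :=
    (continuous_const_add x).continuousAt.preimage_mem_nhds (by simpa using hO)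
  obtain ⟨B, ⟨hB, hBb⟩, hBO⟩ := (nhds_basis_balanced ℝ X).mem_iff.1 h0
  refine ⟨(fun y => x + y) '' B, ?_, image_subset_iff.2 hBO, ?_⟩
  · simpa using (Homeomorph.addLeft x).isOpenMap.image_mem_nhds hB
  · exact (hBb.starConvex.isPathConnected (mem_of_mem_nhds hB)).isConnected.isPreconnected.image
      _ (continuous_const_add x).continuousOn

/-- If a neighbourhood `V` of `x` lies on one side of each of the sets `q • W` with `q > 0`
rational, then `W - W` is the whole space. -/
theorem sub_eq_univ_of_forall_subset_or_disjoint {W V : Set X} {x : X} (hW : W ∈ 𝓝 0)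
    (hV : V ∈ 𝓝 x)
    (h : ∀ q : ℚ, 0 < q → (V ∩ (q : ℝ) • W).Nonempty → V ⊆ (q : ℝ) • W) (y : X) :
    ∃ a ∈ W, ∃ b ∈ W, a - b = y := by
  have hxV := mem_of_mem_nhds hV
  -- some rational multiple of `W` contains `x`
  obtain ⟨n, hn, hn0⟩ : ∃ n : ℕ, ((n : ℝ)⁻¹) • x ∈ W ∧ 0 < n := by
    have ht : Filter.Tendsto (fun n : ℕ => ((n : ℝ)⁻¹) • x) Filter.atTop (𝓝 0) := by
      simpa using (tendsto_inv_atTop_nhds_zero_nat (𝕜 := ℝ)).smul_const x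
    exact ((ht.eventually hW).and (Filter.eventually_gt_atTop 0)).exists
  -- some rational `t < 1` satisfies `t • x ∈ V`
  obtain ⟨t, ht0, ht1, htV⟩ : ∃ t : ℚ, 0 < t ∧ t < 1 ∧ (t : ℝ) • x ∈ V := by
    have hc : ∀ᶠ s in 𝓝 (1 : ℝ), s • x ∈ V :=
      (continuous_id.smul continuous_const).continuousAt.eventually_mem (by simpa using hV)
    obtain ⟨ε, hε, hball⟩ := Metric.eventually_nhds_iff.1 hc
    obtain ⟨t, h1, h2⟩ := exists_rat_btwn (max_lt (sub_lt_self (1 : ℝ) hε) one_pos)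
    refine ⟨t, ?_, by exact_mod_cast h2, hball ?_⟩
    · exact_mod_cast (le_max_right _ _).trans_lt h1
    · rw [Real.dist_eq, abs_lt]
      constructor <;> linarith [(le_max_left (1 - ε) 0).trans_lt h1]
  -- If `V ⊆ r • W`, then `x ∈ r • W` gives `t • x ∈ (r * t) • W`. As `t • x ∈ V`, all of `V` lies
  -- in `(r * t) • W`.
  have hpow : ∀ k : ℕ, V ⊆ ((n * t ^ k : ℚ) : ℝ) • W := by
    intro k
    induction k with
    | zero =>
      refine h _ (by positivity) ⟨x, hxV, ?_⟩
      rw [mem_smul_set_iff_inv_smul_mem₀ (by positivity)]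
      simpa using hn
    | succ k ih =>
      refine h _ (by positivity) ⟨_, htV, ?_⟩
      obtain ⟨w, hw, hwx⟩ := ih hxV
      refine ⟨w, hw, ?_⟩
      simp only at hwx ⊢
      rw [← hwx, smul_smul]
      congr 1
      push_cast
      ring
  have hs : Filter.Tendsto (fun k : ℕ => ((n * t ^ k : ℚ) : ℝ)) Filter.atTop (𝓝 0) := by
    have := (tendsto_pow_atTop_nhds_zero_of_lt_one (r := (t : ℝ)) (by positivity)
      (by exact_mod_cast ht1)).const_mul (n : ℝ)
    simpa using this
  have hy : Filter.Tendsto (fun k : ℕ => x + ((n * t ^ k : ℚ) : ℝ) • y) Filter.atTop (𝓝 x) := by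
    simpa using (hs.smul_const y).const_add x
  -- With `r = n * t ^ k` small, both `x` and `x + r • y` lie in `V ⊆ r • W`; subtract and divide by
  -- `r`.
  obtain ⟨k, hk⟩ := (hy.eventually hV).exists
  have hpos : ((n * t ^ k : ℚ) : ℝ) ≠ 0 := by positivity
  obtain ⟨a, ha, hax⟩ := hpow k hk
  obtain ⟨b, hb, hbx⟩ := hpow k hxV
  refine ⟨a, ha, b, hb, smul_right_injective X hpos ?_⟩
  simp only at hax hbx ⊢
  rw [smul_sub, hax, hbx, add_sub_cancel_left]

theorem noNonzeroNormalBaireMeasure_of_topologicalVectorSpace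
    (h : ∃ U : Set X, IsOpen U ∧ (0 : X) ∈ U ∧ U ≠ univ) : NoNonzeroNormalBaireMeasure X := by
  obtain ⟨U, hUo, hU0, hU⟩ := h
  obtain ⟨y, hy⟩ := (ne_univ_iff_exists_notMem U).1 hU
  have hsub : Filter.Tendsto (fun p : X × X => p.1 - p.2) (𝓝 0 ×ˢ 𝓝 0) (𝓝 0) := by
    have := (continuous_sub (G := X)).tendsto (0, 0)
    rwa [nhds_prod_eq, sub_zero] at this
  obtain ⟨W', hW', hWU⟩ := Filter.mem_prod_same_iff.1 (hsub (hUo.mem_nhds hU0))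
  obtain ⟨W, hWW', hWo, hW0⟩ := mem_nhds_iff.1 hW'
  have : CompletelyRegularSpace X :=
    CompletelyRegularSpace.of_exists_uniformSpace
      ⟨IsTopologicalAddGroup.rightUniformSpace X, rfl⟩
  have hqW : ∀ q : {q : ℚ // 0 < q}, IsOpen ((q : ℝ) • W) := fun q =>
    hWo.smul₀ (by exact_mod_cast q.2.ne')
  refine noNonzeroNormalBaireMeasure_of_dense_iUnion
    (N := fun q : {q : ℚ // 0 < q} => frontier ((q : ℝ) • W)) (fun _ => isClosed_frontier)
    (fun q => ?_) ?_
  · rw [← frontier_compl]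
    exact interior_frontier (hqW q).isClosed_compl
  rw [dense_iff_inter_open]
  rintro O hO ⟨x, hx⟩
  obtain ⟨V, hV, hVO, hVc⟩ := exists_isPreconnected_mem_nhds (hO.mem_nhds hx)
  by_contra hne
  -- If `O` missed every frontier, the connected `V` would lie on one side of each multiple of `W`,
  -- making `W - W ⊆ U` the whole space.
  obtain ⟨a, ha, b, hb, hab⟩ := sub_eq_univ_of_forall_subset_or_disjoint (hWo.mem_nhds hW0) hV
    (fun q hq hqV z hz => by
      by_contra hzW
      obtain ⟨w, hw, hwf⟩ := hVc.inter_frontier_nonempty_of_inter_compl hqV ⟨z, hz, hzW⟩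
      exact hne ⟨w, hVO hw, mem_iUnion.2 ⟨⟨q, hq⟩, hwf⟩⟩) y
  exact hy (hab ▸ hWU (mk_mem_prod (hWW' ha) (hWW' hb)))

end TopologicalVectorSpace

/-! ### Locally connected spaces -/

section LocallyConnected

variable {X : Type u} [TopologicalSpace X] [CompletelyRegularSpace X] {μ : zeroSetAlgebra X → ℝ}

/-- Some closed nowhere dense set cuts the space into connected pieces of outer measure at most
`ε`. -/
theorem exists_nowhereDense_forall_isPreconnected_outerLE [T1Space X] (hμ : IsBaireMeasure μ)
    (hn : IsNormalBaire μ) (h : ∀ x : X, ¬ IsOpen ({x} : Set X)) {ε : ℝ} (hε : 0 < ε) :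
    ∃ N : Set X, IsClosed N ∧ interior N = ∅ ∧
      ∀ C : Set X, IsPreconnected C → Disjoint C N → OuterLE μ C ε := by
  -- `N` will be the complement of the union of a maximal disjoint family of small open sets.
  obtain ⟨P, hP⟩ := zorn_subset
    {P : Set (Set X) | (∀ A ∈ P, IsOpen A ∧ OuterLE μ A ε) ∧ P.PairwiseDisjoint id}
    fun c hc hch => ⟨⋃₀ c, ⟨fun A ⟨s, hs, hA⟩ => (hc hs).1 A hA,
      (pairwiseDisjoint_sUnion hch.directedOn).2 fun s hs => (hc hs).2⟩,
      fun s => subset_sUnion_of_mem⟩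
  refine ⟨(⋃₀ P)ᶜ, (isOpen_sUnion fun A hA => (hP.prop.1 A hA).1).isClosed_compl, ?_, ?_⟩
  · refine eq_empty_of_forall_notMem fun x hx => ?_
    obtain ⟨V, hV, hxV, hVε⟩ := exists_isOpen_outerLE hμ hn (isClosed_singleton (x := x))
      (interior_singleton_eq_empty (h x)) hε
    -- Were the union not dense, this small open set could be adjoined; maximality puts it in `P`,
    -- although it contains `x` outside the union.
    have hW : V ∩ interior (⋃₀ P)ᶜ ∈ P := by
      refine hP.le_of_ge (y := insert (V ∩ interior (⋃₀ P)ᶜ) P) ⟨?_, ?_⟩ (subset_insert _ P)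
        (mem_insert _ P)
      · rintro A (rfl | hA)
        · exact ⟨hV.inter isOpen_interior, hVε.mono inter_subset_left le_rfl⟩
        · exact hP.prop.1 A hA
      · refine hP.prop.2.insert fun A hA _ => ?_
        exact (disjoint_compl_left.mono_right (subset_sUnion_of_mem hA)).mono_left
          (inter_subset_right.trans interior_subset)
    exact interior_subset hx ⟨_, hW, hxV rfl, hx⟩
  · intro C hC hCN
    rw [disjoint_compl_right_iff_subset] at hCN
    rcases C.eq_empty_or_nonempty with rfl | ⟨x, hx⟩
    · exact (OuterLE.empty hμ).mono le_rfl hε.le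
    obtain ⟨A, hA, hxA⟩ := hCN hx
    refine (hP.prop.1 A hA).2.mono ?_ le_rfl
    -- A connected set covered by disjoint open sets lies in the one it meets.
    refine hC.subset_left_of_subset_union (v := ⋃₀ (P \ {A})) (hP.prop.1 A hA).1
      (isOpen_sUnion fun B hB => (hP.prop.1 B hB.1).1)
      (disjoint_sUnion_right.2 fun B hB => hP.prop.2 hA hB.1 (Ne.symm hB.2)) ?_ ⟨x, hx, hxA⟩
    rintro y hy
    obtain ⟨B, hB, hyB⟩ := hCN hy
    by_cases hBA : B = A
    · exact Or.inl (hBA ▸ hyB)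
    · exact Or.inr ⟨B, ⟨hB, hBA⟩, hyB⟩

theorem noNonzeroNormalBaireMeasure_of_locallyConnectedSpace [T1Space X]
    [LocallyConnectedSpace X] (h : ∀ x : X, ¬ IsOpen ({x} : Set X)) :
    NoNonzeroNormalBaireMeasure X := by
  classical
  intro μ hμ hn
  refine hμ.eq_zero_of_univ_le fun ε hε => ?_
  choose N hN hN' hNC using fun k : ℕ => exists_nowhereDense_forall_isPreconnected_outerLE hμ hn h
    (Nat.one_div_pos_of_nat (α := ℝ) (n := k))
  obtain ⟨V, hV, hNV, hVε⟩ := exists_seq_isOpen_outerLE hμ hn hN hN' (half_pos hε)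
  set G : Set X := (closure (⋃ k, V k))ᶜ
  have hGo : IsOpen G := isClosed_closure.isOpen_compl
  have hGN : ∀ k, Disjoint G (N k) := fun k =>
    disjoint_compl_left.mono_right ((hNV k).trans ((subset_iUnion V k).trans subset_closure))
  -- A component of `G` avoids every `N k`, so its outer measure is below every positive bound.
  have hcomp : ∀ (x : X) (δ : ℝ), 0 < δ → OuterLE μ (connectedComponentIn G x) δ := by
    intro x δ hδ
    obtain ⟨k, hk⟩ := exists_nat_one_div_lt hδ
    exact (hNC k _ isPreconnected_connectedComponentIn
      ((hGN k).mono_left (connectedComponentIn_subset G x))).mono le_rfl hk.le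
  refine univ_le_of_directedOn_outerLE hμ hn
    (S := range fun p : Finset ℕ × Finset X =>
      (⋃ k ∈ p.1, V k) ∪ ⋃ x ∈ p.2, connectedComponentIn G x) (range_nonempty _) ?_ ?_ ?_ ?_
  · rw [directedOn_range]
    exact Monotone.directed_le fun p q hpq => union_subset_union
      (biUnion_subset_biUnion_left (Prod.le_def.1 hpq).1)
      (biUnion_subset_biUnion_left (Prod.le_def.1 hpq).2)
  · rintro _ ⟨p, rfl⟩
    exact (isOpen_biUnion fun k _ => hV k).union
      (isOpen_biUnion fun x _ => hGo.connectedComponentIn)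
  · have hd : Dense ((⋃ k, V k) ∪ G) := by
      intro x
      rw [closure_union]
      exact (em (x ∈ closure (⋃ k, V k))).imp id fun hx => subset_closure hx
    refine hd.mono ?_
    rintro x (hx | hx)
    · obtain ⟨k, hk⟩ := mem_iUnion.1 hx
      exact ⟨_, ⟨({k}, ∅), rfl⟩, by simpa using hk⟩
    · exact ⟨_, ⟨(∅, {x}), rfl⟩, by simpa using mem_connectedComponentIn hx⟩
  · rintro _ ⟨⟨s, T⟩, rfl⟩
    -- The components share the remaining `ε / 2`; the `+ 1` keeps the denominator positive when `T`
    -- is empty.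
    have hT := OuterLE.biUnion hμ T (A := connectedComponentIn G)
      (ε := fun _ => ε / 2 / (T.card + 1)) fun x _ => hcomp x _ (by positivity)
    refine ((hVε s).union hμ hT).mono le_rfl ?_
    rw [Finset.sum_const, nsmul_eq_mul]
    have : (T.card : ℝ) * (ε / 2 / (T.card + 1)) ≤ ε / 2 := by
      rw [mul_div_assoc', div_le_iff₀ (by positivity)]
      nlinarith
    linarith

end LocallyConnected

/-! ### Assembly of the cases -/

theorem mainTheorem9 :
    -- separable resolvable spaces, and the two kinds of examples of such spaces
    (∀ (X : Type u) [TopologicalSpace X] [CompletelyRegularSpace X] [Nonempty X],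
      (T1Space X → TopologicalSpace.SeparableSpace X → IsResolvable X →
        NoNonzeroNormalBaireMeasure X) ∧
      (TopologicalSpace.SeparableSpace X →
        (∀ U : Set X, IsOpen U → U.Nonempty → ¬ U.Countable) →
        IsResolvable X ∧ (T1Space X → NoNonzeroNormalBaireMeasure X)) ∧
      (TopologicalSpace.SeparableSpace X → T1Space X → BaireSpace X →
        (∀ x : X, ¬ IsOpen ({x} : Set X)) →
        IsResolvable X ∧ NoNonzeroNormalBaireMeasure X)) ∧
    -- metric spaces
    (∀ (X : Type u) [MetricSpace X] [Nonempty X],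
      (BaireSpace X → (∀ x : X, ¬ IsOpen ({x} : Set X)) → NoNonzeroNormalBaireMeasure X) ∧
      (LocallyConnectedSpace X → Nontrivial X →
        (∃ x₀ : X,
          (∀ r : ℝ, 0 < r → closure {x : X | dist x₀ x < r} = {x : X | dist x₀ x ≤ r}) ∧
          IsConnected {t : ℝ | ∃ x : X, dist x₀ x = t}) →
        NoNonzeroNormalBaireMeasure X)) ∧
    -- real or complex topological vector spaces, not necessarily Hausdorff
    (∀ (𝕜 : Type) [RCLike 𝕜] (X : Type u) [AddCommGroup X] [Module 𝕜 X] [Module ℝ X]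
      [IsScalarTower ℝ 𝕜 X] [TopologicalSpace X] [IsTopologicalAddGroup X] [ContinuousSMul 𝕜 X],
      (BaireSpace X → (∃ U : Set X, IsOpen U ∧ (0 : X) ∈ U ∧ U ≠ univ) →
        NoNonzeroNormalBaireMeasure X) ∧
      ((∃ U : Set X, IsOpen U ∧ (0 : X) ∈ U ∧ Convex ℝ U ∧ U ≠ univ) →
        NoNonzeroNormalBaireMeasure X)) ∧
    -- locally connected Baire spaces
    (∀ (X : Type u) [TopologicalSpace X] [CompletelyRegularSpace X] [Nonempty X],
      LocallyConnectedSpace X → T1Space X → BaireSpace X →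
        (∀ x : X, ¬ IsOpen ({x} : Set X)) → NoNonzeroNormalBaireMeasure X) := by
  refine ⟨fun X _ _ _ => ⟨fun _ _ hr => ?_, fun _ hU => ?_, fun _ _ _ hx => ?_⟩,
    fun X _ _ => ⟨fun _ hx => ?_, fun _ _ ⟨x₀, hcl, hconn⟩ => ?_⟩, ?_,
    fun X _ _ _ _ _ _ hx => noNonzeroNormalBaireMeasure_of_locallyConnectedSpace hx⟩
  · exact noNonzeroNormalBaireMeasure_of_separable hr.not_isOpen_singleton
  · exact ⟨isResolvable_of_not_countable hU, fun _ => noNonzeroNormalBaireMeasure_of_separable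
      fun x hx => hU _ hx (singleton_nonempty x) (countable_singleton x)⟩
  · exact ⟨isResolvable_of_baireSpace hx, noNonzeroNormalBaireMeasure_of_separable hx⟩
  · exact noNonzeroNormalBaireMeasure_of_metricSpace hx
  · exact noNonzeroNormalBaireMeasure_of_metricSpace
      (not_isOpen_singleton_of_closure_ball hcl hconn)
  · intro 𝕜 _ X _ _ _ _ _ _ _
    have : ContinuousSMul ℝ X := IsScalarTower.continuousSMul 𝕜
    exact ⟨fun _ h => noNonzeroNormalBaireMeasure_of_topologicalVectorSpace h,
      fun ⟨U, hU, h0, _, hne⟩ =>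
        noNonzeroNormalBaireMeasure_of_topologicalVectorSpace ⟨U, hU, h0, hne⟩⟩
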